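/- **Model.** There are finitely many queues $i=1,\dots,N$ with lengths $X_i(k)\in\mathbb Z_+$ in slots $k=0,1,2,\dots$, and $X_i(k+1)=X_i(k)+\xi_i(k)-\eta_i(k)$. The arrival vectors $\bar\xi(k)=(\xi_i(k))_i$ are i.i.d. in $k$ with values in $\mathbb Z_+^N$ (their coordinates may depend on each other); $\xi_i$ has the law of $\xi_i(k)$ and $\lambda_i=\mathbb E\xi_i$. The service completions $\eta_i(k)\in\{0,1\}$ have, given $\bar X(k)=\bar x$, a joint law that depends only on $\bar x$, and given $\bar X(k)$ they are independent of $\bar\xi(k)$ and of the past, so $\bar X(\cdot)$ is a Markov chain. Let $\psi_i(\bar x)=\mathbb E(\eta_i(k)\mid \bar X(k)=\bar x)$. It is assumed that $\psi_i(\bar x)=0$ if $x_i=0$ and that, with $g(y)=y^2$, $h(y)=-1/y$ for $y>0$, $h(0)=-\infty$ and $0\cdot(-\infty)=0$, $$\bar\psi(\bar x)\in\operatorname*{arg\,max}_{\bar\mu\in\mathcal C}\ \sum_i g(x_i)h(\mu_i)\qquad\text{for all }\bar x\in\mathbb Z_+^N,$$ where $\mathcal C\subset[0,\infty)^N$ is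 compact and coordinate-convex (if $\bar\mu\in\mathcal C$ and $0\le\bar\mu^*\le\bar\mu$ coordinatewise, then $\bar\mu^*\in\mathcal C$). The chain is considered on a state space $S\subseteq\mathbb Z_+^N$ which it never leaves and on which it is irreducible or, more generally, on which some state is accessible from all states of $S$. **Theorem.** Assume $\mathbb E(\xi_i^3)<\infty$ for all $i$, and let $\bar\nu\in\mathcal C$ satisfy $\lambda_i<\nu_i$ for all $i$. Then the chain is stable: every state that is accessible from all of $S$ (in the irreducible case, every state of $S$) is positive recurrent and is hit in finite mean time from every initial state in $S$, and the chain has a unique stationary distribution on $S$. Moreover, if $\bar X$ has this stationary distribution, then $\mathbb E(X_i^2)<\infty$ for all $i$ and, for every $\varepsilon>0$ such that $\lambda_i<\nu_i-\varepsilon$ for all $i$, $$\varepsilon\sum_i\frac{\mathbb E(X_i^2)}{\nu_i^2}\le A\sum_i\frac{\mathbb E(X_i)}{\nu_i^2}+B,$$ where $$A=3\sum_i\frac{\mathbb E(\xi_i^2)+\lambda_i(1-2\lambda_i)}{\nu_i^2},$$ $$B=\sum_i\frac{\mathbb E(\xi_i^3)-\lambda_i+3\lambda_i^2-3\lambda_i\,\mathbb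 E(\xi_i^2)-3(1-2\lambda_i)\left(\lambda_i^2-\lambda_i/2-\mathbb E(\xi_i^2)/2\right)}{\nu_i^2}.$$ -/

import Mathlib

open MeasureTheory

noncomputable section

/-! ### Markov chains on a countable state space -/

namespace MarkovChain

variable {E : Type*}

/-- `y` can be reached from `x` in finitely many (possibly zero) steps of positive probability. -/
def Accessible (P : E → PMF E) (x y : E) : Prop :=
  Relation.ReflTransGen (fun a b => b ∈ (P a).support) x y

/-- `S` is closed: the chain never leaves it. -/
def IsClosedSet (P : E → PMF E) (S : Set E) : Prop :=
  ∀ x ∈ S, ∀ y ∈ (P x).support, y ∈ S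

/-- `y` is a state of `S` which is accessible from all states of `S`. -/
def IsEssential (P : E → PMF E) (S : Set E) (y : E) : Prop :=
  y ∈ S ∧ ∀ x ∈ S, Accessible P x y

/-- The chain with state space `S` is irreducible up to inessential states: `S` is closed and some
state of `S` is accessible from all of `S`. (If every state of `S` is accessible from every state
of `S`, which is irreducibility in the strict sense, and `S` is closed and nonempty, then this
holds and every state of `S` is essential.) -/
def IsIrreducibleOn (P : E → PMF E) (S : Set E) : Prop :=
  IsClosedSet P S ∧ ∃ y, IsEssential P S y

/-- The joint law of `X(1), …, X(n)` (as a list) for the chain started at `X(0) = x`. -/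
def pathLaw (P : E → PMF E) : ℕ → E → PMF (List E)
  | 0, _ => PMF.pure []
  | n + 1, x => (P x).bind fun y => (pathLaw P n y).map fun l => y :: l

/-- The mean of `τ = inf {n ≥ 1 | X(n) = y}` for the chain started at `X(0) = x`, that is,
`∑ₙ ℙ(τ > n)`, where `τ > n` means that `y` is not among `X(1), …, X(n)`. -/
def meanHittingTime (P : E → PMF E) (x y : E) : ENNReal :=
  ∑' n, (pathLaw P n x).toOuterMeasure {l | y ∉ l}

/-- Positive recurrence on `S`: every state of `S` that is accessible from all of `S` is hit in
finite mean time from every initial state in `S`, itself included. (For a chain that is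
irreducible in the strict sense these are all states of `S`.) -/
def IsPositiveRecurrentOn (P : E → PMF E) (S : Set E) : Prop :=
  ∀ y, IsEssential P S y → ∀ x ∈ S, meanHittingTime P x y < ⊤

/-- `π` is a stationary distribution of the chain with state space `S`. -/
def IsStationaryOn (P : E → PMF E) (S : Set E) (π : PMF E) : Prop :=
  π.bind P = π ∧ π.support ⊆ S

end MarkovChain

/-! ### The network -/

/-- `∑ᵢ g(xᵢ) h(μᵢ)`, with values in `[-∞, ∞]`, where `0 · (-∞) = 0`. -/
def utility {ι : Type*} [Fintype ι] (g : ℕ → ℝ) (h : ℝ → EReal) (x : ι → ℕ) (μ : ι → ℝ) : EReal :=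
  ∑ i, (g (x i) : EReal) * h (μ i)

/-- The `k`-th moment of the `i`-th coordinate of a random vector with law `p`. -/
def coordMoment {ι : Type*} (p : PMF (ι → ℕ)) (k : ℕ) (i : ι) : ℝ :=
  ∫ a, (a i : ℝ) ^ k ∂p.toMeasure

/-- The mean service vector: `meanService q i` is the mean of `ηᵢ` (`true` is `1`, `false` is `0`)
when `η` has law `q`. -/
def meanService {ι : Type*} (q : PMF (ι → Bool)) (i : ι) : ℝ :=
  ∫ e, ((e i).toNat : ℝ) ∂q.toMeasure

/-- A finite single-hop network in discrete time whose mean service rates maximise the utility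
given by `g` and `h` over a compact, coordinate-convex set `C` of nonnegative vectors. In each slot
the arrival vector has law `arrival` (the coordinates may depend on each other); given the
queue lengths `x`, the vector of service completions has law `service x` and is independent
of the arrivals. -/
structure UtilityNetwork (ι : Type*) [Fintype ι] (g : ℕ → ℝ) (h : ℝ → EReal) where
  /-- the law of the arrival vector in a slot -/
  arrival : PMF (ι → ℕ)
  /-- the law of the service vector in a slot, given the queue lengths -/
  service : (ι → ℕ) → PMF (ι → Bool)
  /-- the set of admissible rate vectors -/
  C : Set (ι → ℝ)
  nonneg_of_mem : ∀ μ ∈ C, 0 ≤ μ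
  isCompact_C : IsCompact C
  coordinate_convex : ∀ μ ∈ C, ∀ μ', 0 ≤ μ' → μ' ≤ μ → μ' ∈ C
  meanService_eq_zero : ∀ x i, x i = 0 → meanService (service x) i = 0
  meanService_mem : ∀ x, meanService (service x) ∈ C
  utility_le : ∀ x, ∀ μ ∈ C, utility g h x μ ≤ utility g h x (meanService (service x))

namespace UtilityNetwork

variable {ι : Type*} [Fintype ι] {g : ℕ → ℝ} {h : ℝ → EReal} (M : UtilityNetwork ι g h)

/-- The transition law of the queue lengths: from `x` to `x - η + ξ`. -/
def step (x : ι → ℕ) : PMF (ι → ℕ) :=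
  M.arrival.bind fun a => (M.service x).map fun e i => x i - (e i).toNat + a i

/-- The arrival rate `λᵢ = 𝔼 ξᵢ`. -/
def rate (i : ι) : ℝ := coordMoment M.arrival 1 i

/-- The constant `A`. -/
def constA (ν : ι → ℝ) : ℝ :=
  3 * ∑ i, (coordMoment M.arrival 2 i + M.rate i * (1 - 2 * M.rate i)) / ν i ^ 2

/-- The constant `B`. -/
def constB (ν : ι → ℝ) : ℝ :=
  ∑ i, (coordMoment M.arrival 3 i - M.rate i + 3 * M.rate i ^ 2
      - 3 * M.rate i * coordMoment M.arrival 2 i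
      - 3 * (1 - 2 * M.rate i) *
        (M.rate i ^ 2 - M.rate i / 2 - coordMoment M.arrival 2 i / 2)) / ν i ^ 2

end UtilityNetwork

/-- `g(y) = y²`. -/
def gSq (y : ℕ) : ℝ := (y : ℝ) ^ 2

/-- `h(y) = -1/y` for `y > 0`, and `h(0) = -∞`. -/
def hInv (y : ℝ) : EReal := if y = 0 then ⊥ else ((-y⁻¹ : ℝ) : EReal)

end

/-! The maximiser `ψ(x)` minimises `∑ xᵢ²/μᵢ` over `C`. Comparing it with `ν` and bounding `1/μ`
below by its tangent at `ν` gives `∑ xᵢ²(νᵢ - ψᵢ(x))/νᵢ² ≤ 0` (`sum_sq_mul_sub_serviceRate_le`);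
convexity of `C` plays no role. The weights `1/νᵢ²` suggest the Lyapunov function `∑ xᵢ³/νᵢ²`. The
quadratic part of its drift is `3 ∑ xᵢ²(λᵢ - ψᵢ)/νᵢ²`, hence at most `-3ε ∑ xᵢ²/νᵢ²`, and the rest,
`lowerDrift`, grows at most linearly (`integral_lyapunov_le`).

Foster's criterion (`isPositiveRecurrentOn_of_drift`) then gives positive recurrence. The normalised
occupation measure of an excursion is a stationary distribution, and every stationary distribution
is a multiple of the occupation measure.

For the moment bound, third moments under `π` may be infinite, so the drift inequality cannot simply
be integrated; the comparison theorem `IsStationaryOn.avg_le_avg` truncates instead. It first yields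
finite second moments. Stationarity of the first two moments then determines the means of `ψᵢ` and
`xᵢψᵢ`, hence that of `lowerDrift` (`integral_lowerDrift`), and a second comparison gives the bound,
even with `3ε` in place of `ε`. -/

namespace MarkovChain

open scoped ENNReal

variable {E F : Type*}

/-! ### Expectations of `[0, ∞]`-valued functions -/

/-- The expectation of `f` under `p`, with values in `[0, ∞]`. -/
noncomputable def avg (p : PMF E) (f : E → ℝ≥0∞) : ℝ≥0∞ := ∑' x, p x * f x

lemma avg_mono {p : PMF E} {f g : E → ℝ≥0∞} (h : ∀ x ∈ p.support, f x ≤ g x) :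
    avg p f ≤ avg p g := by
  refine ENNReal.tsum_le_tsum fun x => ?_
  by_cases hx : p x = 0
  · simp [hx]
  · gcongr
    exact h x ((p.mem_support_iff x).2 hx)

lemma avg_add (p : PMF E) (f g : E → ℝ≥0∞) :
    avg p (fun x => f x + g x) = avg p f + avg p g := by
  simp only [avg, mul_add]
  exact ENNReal.tsum_add

lemma avg_const_mul (p : PMF E) (c : ℝ≥0∞) (f : E → ℝ≥0∞) :
    avg p (fun x => c * f x) = c * avg p f := by
  simp only [avg, ← ENNReal.tsum_mul_left]
  exact tsum_congr fun x => by ring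

lemma avg_const (p : PMF E) (c : ℝ≥0∞) : avg p (fun _ => c) = c := by
  simp [avg, ENNReal.tsum_mul_right, p.tsum_coe]

lemma avg_bind (p : PMF E) (q : E → PMF F) (f : F → ℝ≥0∞) :
    avg (p.bind q) f = avg p fun x => avg (q x) f := by
  simp only [avg, PMF.bind_apply, ← ENNReal.tsum_mul_right, ← ENNReal.tsum_mul_left]
  rw [ENNReal.tsum_comm]
  exact tsum_congr fun x => tsum_congr fun y => by ring

lemma avg_pure (x : E) (f : E → ℝ≥0∞) : avg (PMF.pure x) f = f x := by
  classical
  simp [avg, PMF.pure_apply]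

lemma avg_map (p : PMF E) (φ : E → F) (f : F → ℝ≥0∞) :
    avg (p.map φ) f = avg p (f ∘ φ) := by
  rw [← PMF.bind_pure_comp, avg_bind]
  exact congrArg _ (funext fun x => avg_pure _ _)

lemma lintegral_eq_avg [MeasurableSpace E] [Countable E] [MeasurableSingletonClass E]
    (p : PMF E) (f : E → ℝ≥0∞) : ∫⁻ x, f x ∂p.toMeasure = avg p f := by
  rw [lintegral_countable', avg]
  exact tsum_congr fun x => by
    rw [PMF.toMeasure_apply_singleton _ _ (measurableSet_singleton x), mul_comm]

/-! ### The chain killed at a state -/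

open scoped Classical in
/-- The transition operator of the chain killed when it jumps to `y`. -/
noncomputable def taboo (P : E → PMF E) (y : E) (f : E → ℝ≥0∞) (x : E) : ℝ≥0∞ :=
  avg (P x) fun z => if z = y then 0 else f z

section taboo

variable {P : E → PMF E} {S : Set E} {y : E}

lemma taboo_le_avg (f : E → ℝ≥0∞) (x : E) : taboo P y f x ≤ avg (P x) f :=
  avg_mono fun z _ => by split_ifs <;> simp

lemma taboo_mono (hS : IsClosedSet P S) {f g : E → ℝ≥0∞} (h : ∀ x ∈ S, f x ≤ g x) :
    ∀ x ∈ S, taboo P y f x ≤ taboo P y g x := fun x hx =>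
  avg_mono fun z hz => by
    split_ifs
    · exact le_rfl
    · exact h z (hS x hx z hz)

lemma taboo_iterate_mono (hS : IsClosedSet P S) {f g : E → ℝ≥0∞} (h : ∀ x ∈ S, f x ≤ g x)
    (n : ℕ) : ∀ x ∈ S, (taboo P y)^[n] f x ≤ (taboo P y)^[n] g x := by
  induction n with
  | zero => exact h
  | succ n ih =>
    simp only [Function.iterate_succ_apply']
    exact taboo_mono hS ih

lemma taboo_add (f g : E → ℝ≥0∞) :
    taboo P y (f + g) = taboo P y f + taboo P y g := by
  funext x
  rw [Pi.add_apply, taboo, taboo, taboo, ← avg_add]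
  congr 1
  funext z
  split_ifs <;> simp

lemma taboo_smul (c : ℝ≥0∞) (f : E → ℝ≥0∞) :
    taboo P y (c • f) = c • taboo P y f := by
  funext x
  rw [Pi.smul_apply, taboo, taboo, smul_eq_mul, ← avg_const_mul]
  congr 1
  funext z
  split_ifs <;> simp

lemma taboo_iterate_add (n : ℕ) (f g : E → ℝ≥0∞) :
    (taboo P y)^[n] (f + g) = (taboo P y)^[n] f + (taboo P y)^[n] g := by
  induction n with
  | zero => rfl
  | succ n ih => simp only [Function.iterate_succ_apply', ih, taboo_add]

lemma taboo_iterate_smul (n : ℕ) (c : ℝ≥0∞) (f : E → ℝ≥0∞) :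
    (taboo P y)^[n] (c • f) = c • (taboo P y)^[n] f := by
  induction n with
  | zero => rfl
  | succ n ih => simp only [Function.iterate_succ_apply', ih, taboo_smul]

/-- `survival P y n x` is the probability that the chain started at `x` avoids `y` at the times
`1, …, n`. -/
noncomputable def survival (P : E → PMF E) (y : E) (n : ℕ) : E → ℝ≥0∞ := (taboo P y)^[n] 1

lemma survival_succ (n : ℕ) : survival P y (n + 1) = taboo P y (survival P y n) :=
  Function.iterate_succ_apply' _ _ _

lemma survival_le_one (n : ℕ) (x : E) : survival P y n x ≤ 1 := by
  induction n generalizing x with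
  | zero => exact le_rfl
  | succ n ih =>
    rw [survival_succ]
    calc _ ≤ avg (P x) (survival P y n) := taboo_le_avg _ _
      _ ≤ avg (P x) (fun _ => 1) := avg_mono fun z _ => ih z
      _ = 1 := avg_const _ _

lemma survival_antitone (x : E) : Antitone fun n => survival P y n x := by
  refine antitone_nat_of_succ_le fun n => ?_
  have h : ∀ x ∈ Set.univ, taboo P y 1 x ≤ (1 : E → ℝ≥0∞) x := fun x _ =>
    survival_le_one (P := P) (y := y) 1 x
  have := taboo_iterate_mono (P := P) (y := y) (S := Set.univ) (fun _ _ _ _ => trivial) h n x trivial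
  rwa [← Function.iterate_succ_apply] at this

/-- Both sides satisfy the same recursion when the first step is conditioned on. -/
lemma toOuterMeasure_pathLaw (n : ℕ) (x : E) :
    (pathLaw P n x).toOuterMeasure {l | y ∉ l} = survival P y n x := by
  induction n generalizing x with
  | zero =>
    simp [pathLaw, survival, PMF.toOuterMeasure_pure_apply]
  | succ n ih =>
    rw [pathLaw, PMF.toOuterMeasure_bind_apply, survival_succ, taboo, avg]
    refine tsum_congr fun z => ?_
    rw [PMF.toOuterMeasure_map_apply]
    split_ifs with hz
    · subst hz
      simp
    · rw [← ih z]
      congr 2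
      ext l
      simp [Ne.symm hz]

lemma meanHittingTime_eq_tsum (x : E) :
    meanHittingTime P x y = ∑' n, survival P y n x :=
  tsum_congr fun n => toOuterMeasure_pathLaw n x

lemma taboo_lt_one {f : E → ℝ≥0∞} (hf : ∀ z, f z ≤ 1) {x z : E} (hz : z ∈ (P x).support)
    (h : z = y ∨ f z < 1) : taboo P y f x < 1 := by
  classical
  rw [← avg_const (P x) 1, taboo, avg, avg]
  have hle : ∀ w, P x w * (if w = y then 0 else f w) ≤ P x w * 1 := fun w => by
    gcongr
    split_ifs
    · simp
    · exact hf w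
  refine ENNReal.tsum_lt_tsum (i := z) ?_ hle ?_
  · refine ne_top_of_le_ne_top ENNReal.one_ne_top ?_
    calc _ ≤ ∑' w, P x w * 1 := ENNReal.tsum_le_tsum hle
      _ = 1 := by simp [(P x).tsum_coe]
  · refine (ENNReal.mul_lt_mul_iff_right ((P x).mem_support_iff z |>.1 hz)
      ((P x).apply_ne_top z)).2 ?_
    split_ifs with hzy
    · exact zero_lt_one
    · exact h.resolve_left hzy

lemma exists_survival_lt_one (hS : IsClosedSet P S) (hy : IsEssential P S y) {x : E}
    (hx : x ∈ S) : ∃ n, survival P y n x < 1 := by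
  have key : ∀ x, Accessible P x y → x ≠ y → ∃ n, survival P y n x < 1 := by
    intro x hxy
    induction hxy using Relation.ReflTransGen.head_induction_on with
    | refl => exact fun h => (h rfl).elim
    | @head a b hab _ ih =>
      intro _
      by_cases hb : b = y
      · exact ⟨1, taboo_lt_one (fun _ => le_rfl) hab (Or.inl hb)⟩
      · obtain ⟨n, hn⟩ := ih hb
        exact ⟨n + 1, by
          rw [survival_succ]; exact taboo_lt_one (survival_le_one n) hab (Or.inr hn)⟩
  -- `Accessible` allows zero steps, while survival is tested from time 1 on. Taking one step first
  -- also covers `x = y`.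
  obtain ⟨z, hz⟩ := (P x).support_nonempty
  by_cases hzy : z = y
  · exact ⟨1, taboo_lt_one (fun _ => le_rfl) hz (Or.inl hzy)⟩
  · obtain ⟨n, hn⟩ := key z (hy.2 z (hS x hx z hz)) hzy
    exact ⟨n + 1, by rw [survival_succ]; exact taboo_lt_one (survival_le_one n) hz (Or.inr hn)⟩

/-- The expected number of visits to a set of states from which `y` is reached within `m` steps
with probability at least `δ`, before the chain reaches `y`. -/
lemma mul_sum_taboo_iterate_le (hS : IsClosedSet P S) {f : E → ℝ≥0∞} {δ : ℝ≥0∞} {m : ℕ}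
    (h : ∀ x ∈ S, δ * f x + survival P y m x ≤ 1) {x : E} (hx : x ∈ S) (N : ℕ) :
    δ * ∑ n ∈ Finset.range N, (taboo P y)^[n] f x ≤ m := by
  -- The killed operator is applied `n` times to the hypothesis. Summed over `n`, the survival terms
  -- telescope to at most `m` terms, each at most one.
  have hn : ∀ n, δ * (taboo P y)^[n] f x + survival P y (m + n) x ≤ survival P y n x := by
    intro n
    have := taboo_iterate_mono (y := y) hS (f := δ • f + survival P y m) (g := 1)
      (fun x hx => h x hx) n x hx
    rwa [taboo_iterate_add, taboo_iterate_smul, survival, ← Function.iterate_add_apply,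
      Nat.add_comm] at this
  have hsum := Finset.sum_le_sum fun n (_ : n ∈ Finset.range N) => hn n
  rw [Finset.sum_add_distrib, ← Finset.mul_sum] at hsum
  have hfin : ∑ n ∈ Finset.range N, survival P y (m + n) x ≠ ⊤ :=
    ENNReal.sum_ne_top.2 fun n _ => ne_top_of_le_ne_top ENNReal.one_ne_top (survival_le_one _ _)
  have hle : ∑ n ∈ Finset.range N, survival P y n x
      ≤ m + ∑ n ∈ Finset.range N, survival P y (m + n) x := by
    calc _ ≤ ∑ n ∈ Finset.range (m + N), survival P y n x :=
          Finset.sum_le_sum_of_subset (Finset.range_subset_range.2 (Nat.le_add_left _ _))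
      _ = ∑ n ∈ Finset.range m, survival P y n x
            + ∑ n ∈ Finset.range N, survival P y (m + n) x := Finset.sum_range_add _ _ _
      _ ≤ _ := by
        gcongr
        calc _ ≤ ∑ n ∈ Finset.range m, (1 : ℝ≥0∞) :=
              Finset.sum_le_sum fun n _ => survival_le_one _ _
          _ = m := by simp
  exact (ENNReal.add_le_add_iff_right hfin).1 (hsum.trans hle)

/-- Killing only lowers the mean of `V`, so the drift inequality holds for the killed chain; its
iterates telescope. -/
lemma sum_survival_le (hS : IsClosedSet P S) {V f : E → ℝ≥0∞}
    (h : ∀ x ∈ S, avg (P x) V + 1 ≤ V x + f x) (N : ℕ) :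
    ∀ x ∈ S, (taboo P y)^[N] V x + ∑ n ∈ Finset.range N, survival P y n x
      ≤ V x + ∑ n ∈ Finset.range N, (taboo P y)^[n] f x := by
  induction N with
  | zero => simp
  | succ N ih =>
    intro x hx
    have h1 := taboo_iterate_mono (y := y) hS (f := taboo P y V + 1) (g := V + f)
      (fun x hx => (add_le_add_left (taboo_le_avg V x) 1).trans (h x hx)) N x hx
    rw [taboo_iterate_add, taboo_iterate_add, ← Function.iterate_succ_apply] at h1
    rw [Finset.sum_range_succ, Finset.sum_range_succ]
    simp only [Pi.add_apply] at h1
    calc _ = ((taboo P y)^[N + 1] V x + (taboo P y)^[N] 1 x)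
          + ∑ n ∈ Finset.range N, survival P y n x := by rw [survival]; ring
      _ ≤ ((taboo P y)^[N] V x + (taboo P y)^[N] f x)
          + ∑ n ∈ Finset.range N, survival P y n x := by gcongr
      _ = ((taboo P y)^[N] V x + ∑ n ∈ Finset.range N, survival P y n x)
          + (taboo P y)^[N] f x := by ring
      _ ≤ (V x + ∑ n ∈ Finset.range N, (taboo P y)^[n] f x) + (taboo P y)^[N] f x :=
          add_le_add_left (ih x hx) _
      _ = _ := by ring

/-- The Foster–Lyapunov criterion for positive recurrence. -/
theorem isPositiveRecurrentOn_of_drift (hS : IsClosedSet P S) {V : E → ℝ≥0∞}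
    (hV : ∀ x, V x ≠ ⊤) {K : Set E} (hK : K.Finite) {b : ℝ≥0∞} (hb : b ≠ ⊤)
    (h : ∀ x ∈ S, avg (P x) V + 1 ≤ V x + b * K.indicator 1 x) :
    IsPositiveRecurrentOn P S := by
  intro y hy x hx
  -- Survival decreases in time and `K ∩ S` is finite, so one horizon serves all its states.
  obtain ⟨m, hm⟩ : ∃ m, ∀ x ∈ K ∩ S, survival P y m x < 1 := by
    have hfin := hK.inter_of_left S
    choose! n hn using fun x (hx : x ∈ S) => exists_survival_lt_one hS hy hx
    obtain ⟨m, hm⟩ := (hfin.image n).bddAbove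
    exact ⟨m, fun x hx => (survival_antitone x (hm ⟨x, hx, rfl⟩)).trans_lt (hn x hx.2)⟩
  obtain ⟨δ, hδ0, hδ⟩ : ∃ δ : ℝ≥0∞, δ ≠ 0 ∧ ∀ x ∈ K ∩ S, δ + survival P y m x ≤ 1 := by
    have hfin := hK.inter_of_left S
    -- If `K ∩ S` is empty, this infimum is `⊤`, which does no harm.
    refine ⟨hfin.toFinset.inf fun x => 1 - survival P y m x, ?_, fun x hx => ?_⟩
    · rw [← pos_iff_ne_zero, Finset.lt_inf_iff ENNReal.zero_lt_top]
      intro x hx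
      exact tsub_pos_of_lt (hm x (hfin.mem_toFinset.1 hx))
    · calc _ ≤ (1 - survival P y m x) + survival P y m x := by
            gcongr
            exact Finset.inf_le (hfin.mem_toFinset.2 hx)
        _ = 1 := tsub_add_cancel_of_le (survival_le_one _ _)
  have hδ' : ∀ x ∈ S, δ * K.indicator 1 x + survival P y m x ≤ 1 := by
    intro x hx
    by_cases hxK : x ∈ K
    · simpa [hxK] using hδ x ⟨hxK, hx⟩
    · simpa [hxK] using survival_le_one m x
  have hbound : ∀ N, ∑ n ∈ Finset.range N, survival P y n x ≤ V x + b * (m / δ) := by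
    intro N
    refine le_add_self.trans ((sum_survival_le (y := y) hS h N x hx).trans ?_)
    have h2 : (fun x => b * K.indicator 1 x) = b • K.indicator (1 : E → ℝ≥0∞) := rfl
    simp only [h2, taboo_iterate_smul, Pi.smul_apply, smul_eq_mul, ← Finset.mul_sum]
    gcongr
    rw [ENNReal.le_div_iff_mul_le (Or.inl hδ0) (Or.inr (ENNReal.natCast_ne_top m)), mul_comm]
    exact mul_sum_taboo_iterate_le hS hδ' hx N
  rw [meanHittingTime_eq_tsum, ENNReal.tsum_eq_iSup_nat]
  refine (iSup_le hbound).trans_lt (ENNReal.add_lt_top.2 ⟨(hV x).lt_top, ?_⟩)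
  exact ENNReal.mul_lt_top hb.lt_top (ENNReal.div_lt_top (ENNReal.natCast_ne_top m) hδ0)

end taboo

/-! ### Stationary distributions -/

open scoped Classical in
/-- `excursion P y n z` is the probability that the chain started at `y` is at `z` at time `n`
without having returned to `y` at the times `1, …, n`. -/
noncomputable def excursion (P : E → PMF E) (y : E) : ℕ → E → ℝ≥0∞
  | 0, z => if z = y then 1 else 0
  | n + 1, z => if z = y then 0 else ∑' w, excursion P y n w * P w z

/-- The expected number of visits to `z` in an excursion of the chain from `y`. -/
noncomputable def occupation (P : E → PMF E) (y z : E) : ℝ≥0∞ := ∑' n, excursion P y n z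

section stationary

variable {P : E → PMF E} {S : Set E} {y : E}

/-- Duality: each step of the killed kernel is moved from the measure to the function. With `f = 1`
this links the occupation measure to the mean return time. -/
lemma tsum_excursion_mul (n : ℕ) (f : E → ℝ≥0∞) :
    ∑' z, excursion P y n z * f z = (taboo P y)^[n] f y := by
  classical
  induction n generalizing f with
  | zero => simp [excursion]
  | succ n ih =>
    rw [Function.iterate_succ_apply, ← ih]
    simp only [taboo, avg, ← ENNReal.tsum_mul_left]
    rw [ENNReal.tsum_comm]
    refine tsum_congr fun z => ?_
    simp only [excursion]
    split_ifs
    · simp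
    · rw [← ENNReal.tsum_mul_right]
      exact tsum_congr fun w => by ring

lemma tsum_occupation : ∑' z, occupation P y z = meanHittingTime P y y := by
  simp only [occupation]
  rw [ENNReal.tsum_comm, meanHittingTime_eq_tsum]
  exact tsum_congr fun n => by
    simpa [survival] using tsum_excursion_mul (P := P) (y := y) n 1

lemma occupation_self : occupation P y y = 1 := by
  rw [occupation, tsum_eq_single 0]
  · simp [excursion]
  · rintro (_ | n) hn
    · exact (hn rfl).elim
    · simp [excursion]

lemma occupation_eq_of_ne {z : E} (hz : z ≠ y) :
    ∑' w, occupation P y w * P w z = occupation P y z := by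
  simp only [occupation, ← ENNReal.tsum_mul_right]
  rw [ENNReal.tsum_comm, tsum_eq_zero_add' (f := fun n => excursion P y n z) ENNReal.summable]
  simp [excursion, hz]

lemma tsum_tsum_mul (μ : E → ℝ≥0∞) : ∑' z, ∑' w, μ w * P w z = ∑' w, μ w := by
  rw [ENNReal.tsum_comm]
  exact tsum_congr fun w => by rw [ENNReal.tsum_mul_left, (P w).tsum_coe, mul_one]

/-- Away from `y` this is an index shift. At `y` it follows because the kernel preserves total mass;
the other equations may be subtracted since that mass, the mean return time, is finite. -/
lemma occupation_invariant (h : meanHittingTime P y y ≠ ⊤) (z : E) :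
    ∑' w, occupation P y w * P w z = occupation P y z := by
  classical
  by_cases hz : z = y
  · subst hz
    have h1 := tsum_tsum_mul (P := P) (occupation P z)
    rw [ENNReal.tsum_eq_add_tsum_ite (f := fun w => ∑' v, occupation P z v * P v w) z,
      ENNReal.tsum_eq_add_tsum_ite (f := occupation P z) z] at h1
    have h2 : (∑' w, if w = z then 0 else ∑' v, occupation P z v * P v w)
        = ∑' w, if w = z then 0 else occupation P z w := by
      refine tsum_congr fun w => ?_
      split_ifs with hw
      · rfl
      · exact occupation_eq_of_ne hw
    rw [h2] at h1
    refine (ENNReal.add_left_inj (ne_top_of_le_ne_top h ?_)).1 h1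
    rw [← tsum_occupation]
    exact ENNReal.tsum_le_tsum fun w => by split_ifs <;> simp
  · exact occupation_eq_of_ne hz

lemma excursion_eq_zero (hS : IsClosedSet P S) (hy : y ∈ S) (n : ℕ) {z : E} (hz : z ∉ S) :
    excursion P y n z = 0 := by
  induction n generalizing z with
  | zero =>
    have : z ≠ y := fun h => hz (h ▸ hy)
    simp [excursion, this]
  | succ n ih =>
    simp only [excursion]
    split_ifs
    · rfl
    · refine ENNReal.tsum_eq_zero.2 fun w => ?_
      by_cases hw : w ∈ S
      · have : P w z = 0 := by
          by_contra h0
          exact hz (hS w hw z (((P w).mem_support_iff z).2 h0))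
        simp [this]
      · simp [ih hw]

lemma occupation_eq_zero (hS : IsClosedSet P S) (hy : y ∈ S) {z : E} (hz : z ∉ S) :
    occupation P y z = 0 :=
  ENNReal.tsum_eq_zero.2 fun n => excursion_eq_zero hS hy n hz

lemma exists_isStationaryOn (hS : IsClosedSet P S) (hy : y ∈ S)
    (h : meanHittingTime P y y ≠ ⊤) : ∃ π, IsStationaryOn P S π := by
  have h0 : ∑' z, occupation P y z ≠ 0 := fun h0 => by
    have := ENNReal.tsum_eq_zero.1 h0 y
    rw [occupation_self] at this
    exact one_ne_zero this
  have htop : ∑' z, occupation P y z ≠ ⊤ := by rwa [tsum_occupation]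
  refine ⟨PMF.normalize (occupation P y) h0 htop, ?_, ?_⟩
  · ext z
    rw [PMF.bind_apply, PMF.normalize_apply, ← occupation_invariant h z, ← ENNReal.tsum_mul_right]
    refine tsum_congr fun w => ?_
    rw [PMF.normalize_apply]
    ring
  · intro z hz
    by_contra hzS
    rw [PMF.mem_support_iff, PMF.normalize_apply, occupation_eq_zero hS hy hzS] at hz
    simp at hz

lemma IsStationaryOn.tsum_mul {π : PMF E} (hπ : IsStationaryOn P S π) (z : E) :
    ∑' w, π w * P w z = π z := by
  rw [← PMF.bind_apply, hπ.1]

/-- Minimality of the occupation measure: at `y` only time 0 counts, and elsewhere one step of the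
invariance of `π` reproduces the bound. -/
lemma IsStationaryOn.mul_sum_excursion_le {π : PMF E} (hπ : IsStationaryOn P S π) (N : ℕ)
    (z : E) : π y * ∑ n ∈ Finset.range N, excursion P y n z ≤ π z := by
  induction N generalizing z with
  | zero => simp
  | succ N ih =>
    rw [Finset.sum_range_succ']
    by_cases hz : z = y
    · simp [excursion, hz]
    · simp only [excursion, hz, if_false, add_zero]
      rw [← hπ.tsum_mul z, ← Summable.tsum_finsetSum fun _ _ => ENNReal.summable,
        ← ENNReal.tsum_mul_left]
      refine ENNReal.tsum_le_tsum fun w => ?_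
      rw [← Finset.sum_mul, ← mul_assoc]
      gcongr
      exact ih w

lemma eq_zero_of_accessible {ρ : E → ℝ≥0∞} (hρ : ∀ z, ∑' w, ρ w * P w z = ρ z)
    (hy : ρ y = 0) {x : E} (hxy : Accessible P x y) : ρ x = 0 := by
  induction hxy using Relation.ReflTransGen.head_induction_on with
  | refl => exact hy
  | @head a b hab _ ih =>
    have h1 := hρ b
    rw [ih] at h1
    exact (mul_eq_zero.1 (ENNReal.tsum_eq_zero.1 h1 a)).resolve_right
      (((P a).mem_support_iff b).1 hab)

/-- The difference of the two sides is an invariant measure that vanishes at `y`. Zeros of an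
invariant measure spread backwards along transitions, so it vanishes wherever `y` is accessible,
hence on `S`. -/
lemma IsStationaryOn.eq_mul_occupation {π : PMF E} (hπ : IsStationaryOn P S π)
    (hy : IsEssential P S y) (h : meanHittingTime P y y ≠ ⊤) (z : E) :
    π z = π y * occupation P y z := by
  have hle : ∀ z, π y * occupation P y z ≤ π z := fun z => by
    rw [occupation, ENNReal.tsum_eq_iSup_nat, ENNReal.mul_iSup]
    exact iSup_le fun N => hπ.mul_sum_excursion_le N z
  set ρ : E → ℝ≥0∞ := fun z => π z - π y * occupation P y z with hρdef
  have hadd : ∀ z, ρ z + π y * occupation P y z = π z := fun z => tsub_add_cancel_of_le (hle z)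
  have hρ : ∀ z, ∑' w, ρ w * P w z = ρ z := by
    intro z
    have h1 := hπ.tsum_mul z
    have h2 : ∀ w, π w * P w z = ρ w * P w z + π y * (occupation P y w * P w z) := fun w => by
      rw [← hadd w]; ring
    simp only [h2] at h1
    rw [ENNReal.tsum_add, ENNReal.tsum_mul_left, occupation_invariant h, ← hadd z] at h1
    exact (ENNReal.add_left_inj
      (ne_top_of_le_ne_top (π.apply_ne_top z) (hle z))).1 h1
  have hρy : ρ y = 0 := by simp [hρdef, occupation_self]
  rw [← hadd z]
  suffices ρ z = 0 by rw [this, zero_add]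
  by_cases hz : z ∈ S
  · exact eq_zero_of_accessible hρ hρy (hy.2 z hz)
  · have : π z = 0 := by
      by_contra h0
      exact hz (hπ.2 ((π.mem_support_iff z).2 h0))
    simp [hρdef, this]

/-- A positive recurrent chain has exactly one stationary distribution. -/
theorem IsPositiveRecurrentOn.existsUnique (hP : IsPositiveRecurrentOn P S)
    (hS : IsIrreducibleOn P S) : ∃! π, IsStationaryOn P S π := by
  obtain ⟨hcl, y, hy⟩ := hS
  have h := (hP y hy y hy.1).ne
  obtain ⟨π, hπ⟩ := exists_isStationaryOn hcl hy.1 h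
  -- Total mass one fixes the remaining factor.
  have hy_eq : ∀ π', IsStationaryOn P S π' → π' y = (meanHittingTime P y y)⁻¹ := by
    intro π' hπ'
    refine ENNReal.eq_inv_of_mul_eq_one_left ?_
    rw [← tsum_occupation, ← ENNReal.tsum_mul_left, ← π'.tsum_coe]
    exact tsum_congr fun z => (hπ'.eq_mul_occupation hy h z).symm
  refine ⟨π, hπ, fun π' hπ' => ?_⟩
  ext z
  rw [hπ.eq_mul_occupation hy h z, hπ'.eq_mul_occupation hy h z, hy_eq _ hπ, hy_eq _ hπ']

lemma IsStationaryOn.avg_avg {π : PMF E} (hπ : IsStationaryOn P S π) (f : E → ℝ≥0∞) :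
    avg π (fun x => avg (P x) f) = avg π f := by
  rw [← avg_bind, hπ.1]

/-- The comparison theorem: a drift inequality bounds stationary means, also if the mean of the
Lyapunov function itself is infinite. -/
theorem IsStationaryOn.avg_le_avg {π : PMF E} (hπ : IsStationaryOn P S π)
    {V f g : E → ℝ≥0∞} (hV : ∀ x, V x ≠ ⊤) (h : ∀ x, avg (P x) V + f x ≤ V x + g x) :
    avg π f ≤ avg π g := by
  have hn : ∀ n : ℕ, avg π ({x | V x ≤ n}.indicator f) ≤ avg π g := by
    intro n
    -- The truncation `min V n` keeps the drift inequality where `V ≤ n`; elsewhere its mean cannot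
    -- rise above `n`. Its stationary mean is finite and cancels.
    have hpt : ∀ x, avg (P x) (fun z => min (V z) n) + {x | V x ≤ n}.indicator f x
        ≤ min (V x) n + g x := by
      intro x
      by_cases hx : V x ≤ n
      · rw [Set.indicator_of_mem (show x ∈ {x | V x ≤ n} from hx), min_eq_left hx]
        refine le_trans ?_ (h x)
        gcongr
        exact avg_mono fun z _ => min_le_left _ _
      · rw [Set.indicator_of_notMem (show x ∉ {x | V x ≤ n} from hx),
          min_eq_right (not_le.1 hx).le, add_zero]
        refine le_trans ?_ le_self_add
        calc _ ≤ avg (P x) (fun _ => (n : ℝ≥0∞)) := avg_mono fun z _ => min_le_right _ _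
          _ = n := avg_const _ _
    have hint := avg_mono (p := π) fun x _ => hpt x
    rw [avg_add, avg_add, hπ.avg_avg] at hint
    refine (ENNReal.add_le_add_iff_left (ne_top_of_le_ne_top (ENNReal.natCast_ne_top n) ?_)).1 hint
    calc _ ≤ avg π (fun _ => (n : ℝ≥0∞)) := avg_mono fun z _ => min_le_right _ _
      _ = n := avg_const _ _
  -- Monotone convergence: as `V` is finite, every finite set of states lies in some level set.
  have hsup : avg π f = ⨆ n : ℕ, avg π ({x | V x ≤ n}.indicator f) := by
    simp only [avg, ENNReal.tsum_eq_iSup_sum]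
    rw [iSup_comm]
    refine iSup_congr fun s => le_antisymm ?_ (iSup_le fun n => Finset.sum_le_sum fun x _ => ?_)
    · obtain ⟨n, hn⟩ : ∃ n : ℕ, ∀ x ∈ s, V x ≤ n := by
        obtain ⟨n, hn⟩ := ENNReal.exists_nat_gt
          (ENNReal.sum_ne_top.2 fun x (_ : x ∈ s) => hV x)
        exact ⟨n, fun x hx => (Finset.single_le_sum (f := V) (fun _ _ => zero_le) hx).trans hn.le⟩
      refine le_iSup_of_le n (Finset.sum_le_sum fun x hx => ?_)
      rw [Set.indicator_of_mem (show x ∈ {x | V x ≤ n} from hn x hx)]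
    · gcongr
      exact Set.indicator_le_self _ _ _
  rw [hsup]
  exact iSup_le hn

end stationary

end MarkovChain

namespace MarkovChain

variable {E : Type*} [Countable E] [MeasurableSpace E] [MeasurableSingletonClass E]

/-! ### Real-valued drift conditions -/

lemma avg_ofReal {p : PMF E} {f : E → ℝ} (hf : ∀ x, 0 ≤ f x) (hi : Integrable f p.toMeasure) :
    avg p (fun x => ENNReal.ofReal (f x)) = ENNReal.ofReal (∫ x, f x ∂p.toMeasure) := by
  rw [ofReal_integral_eq_lintegral_ofReal hi (Filter.Eventually.of_forall hf), lintegral_eq_avg]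

lemma integrable_of_avg {p : PMF E} {f : E → ℝ} (hf : ∀ x, 0 ≤ f x)
    (h : avg p (fun x => ENNReal.ofReal (f x)) ≠ ⊤) : Integrable f p.toMeasure :=
  (lintegral_ofReal_ne_top_iff_integrable (measurable_of_countable f).aestronglyMeasurable
    (Filter.Eventually.of_forall hf)).1 (by rwa [lintegral_eq_avg])

lemma integral_eq_toReal_avg {p : PMF E} {f : E → ℝ} (hf : ∀ x, 0 ≤ f x) :
    ∫ x, f x ∂p.toMeasure = (avg p (fun x => ENNReal.ofReal (f x))).toReal := by
  rw [integral_eq_lintegral_of_nonneg_ae (Filter.Eventually.of_forall hf)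
    (measurable_of_countable f).aestronglyMeasurable, lintegral_eq_avg]

variable {P : E → PMF E} {S : Set E}

theorem IsStationaryOn.integral_le_integral {π : PMF E} (hπ : IsStationaryOn P S π)
    {V f g : E → ℝ} (hV : ∀ x, 0 ≤ V x) (hf : ∀ x, 0 ≤ f x) (hg : ∀ x, 0 ≤ g x)
    (hVi : ∀ x, Integrable V (P x).toMeasure)
    (h : ∀ x, ∫ z, V z ∂(P x).toMeasure + f x ≤ V x + g x) (hgi : Integrable g π.toMeasure) :
    Integrable f π.toMeasure ∧ ∫ x, f x ∂π.toMeasure ≤ ∫ x, g x ∂π.toMeasure := by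
  have key : avg π (fun x => ENNReal.ofReal (f x)) ≤ avg π (fun x => ENNReal.ofReal (g x)) := by
    refine hπ.avg_le_avg (V := fun x => ENNReal.ofReal (V x)) (fun _ => ENNReal.ofReal_ne_top)
      fun x => ?_
    rw [avg_ofReal hV (hVi x), ← ENNReal.ofReal_add (integral_nonneg hV) (hf x),
      ← ENNReal.ofReal_add (hV x) (hg x)]
    exact ENNReal.ofReal_le_ofReal (h x)
  have htop : avg π (fun x => ENNReal.ofReal (g x)) ≠ ⊤ := by
    rw [avg_ofReal hg hgi]; exact ENNReal.ofReal_ne_top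
  refine ⟨integrable_of_avg hf (ne_top_of_le_ne_top htop key), ?_⟩
  rw [integral_eq_toReal_avg hf, integral_eq_toReal_avg hg]
  exact ENNReal.toReal_mono htop key

/-- Integrability under `π` is not needed: both integrals are `toReal` of the same value in `[0,
∞]`. -/
lemma IsStationaryOn.integral_integral {π : PMF E} (hπ : IsStationaryOn P S π)
    {V : E → ℝ} (hV : ∀ x, 0 ≤ V x) (hVi : ∀ x, Integrable V (P x).toMeasure) :
    ∫ x, ∫ z, V z ∂(P x).toMeasure ∂π.toMeasure = ∫ x, V x ∂π.toMeasure := by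
  rw [integral_eq_toReal_avg fun x => integral_nonneg hV, integral_eq_toReal_avg hV,
    ← hπ.avg_avg fun x => ENNReal.ofReal (V x)]
  congr 2
  funext x
  exact (avg_ofReal hV (hVi x)).symm

/-- Where `f ≥ b + 1` the drift is at most `-1`; on the finite remainder the constant `b + 1` pays
for `b` and for the unit decrease. -/
theorem isPositiveRecurrentOn_of_integral_drift (hS : IsClosedSet P S) {V f : E → ℝ}
    (hV : ∀ x, 0 ≤ V x) (hf : ∀ x, 0 ≤ f x) (hVi : ∀ x, Integrable V (P x).toMeasure) {b : ℝ}
    (hb : 0 ≤ b) (hfin : {x | f x < b + 1}.Finite)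
    (h : ∀ x, ∫ z, V z ∂(P x).toMeasure + f x ≤ V x + b) : IsPositiveRecurrentOn P S := by
  refine isPositiveRecurrentOn_of_drift hS (V := fun x => ENNReal.ofReal (V x))
    (fun _ => ENNReal.ofReal_ne_top) hfin (b := ENNReal.ofReal (b + 1)) ENNReal.ofReal_ne_top
    fun x _ => ?_
  rw [avg_ofReal hV (hVi x), ← ENNReal.ofReal_one, ← ENNReal.ofReal_add (integral_nonneg hV)
    zero_le_one]
  by_cases hx : f x < b + 1
  · rw [Set.indicator_of_mem (show x ∈ {x | f x < b + 1} from hx), Pi.one_apply, mul_one,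
      ← ENNReal.ofReal_add (hV x) (by linarith)]
    exact ENNReal.ofReal_le_ofReal (by linarith [h x, hf x])
  · rw [Set.indicator_of_notMem (show x ∉ {x | f x < b + 1} from hx), mul_zero, add_zero]
    exact ENNReal.ofReal_le_ofReal (by linarith [h x])

end MarkovChain

/-! ### Moments of the arrivals -/

lemma coordMoment_nonneg {ι : Type*} [Fintype ι] (p : PMF (ι → ℕ)) (k : ℕ) (i : ι) :
    0 ≤ coordMoment p k i := integral_nonneg fun _ => by positivity

lemma coordMoment_one {ι : Type*} [Fintype ι] (p : PMF (ι → ℕ)) (i : ι) :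
    coordMoment p 1 i = ∫ x, (x i : ℝ) ∂p.toMeasure := by
  simp [coordMoment]

lemma integrable_pow_of_le {ι : Type*} [Fintype ι] {p : PMF (ι → ℕ)} {i : ι} {m n : ℕ}
    (hmn : m ≤ n) (h : Integrable (fun a : ι → ℕ => (a i : ℝ) ^ n) p.toMeasure) :
    Integrable (fun a : ι → ℕ => (a i : ℝ) ^ m) p.toMeasure := by
  refine (h.add (integrable_const 1)).mono' (measurable_of_countable _).aestronglyMeasurable
    (Filter.Eventually.of_forall fun a => ?_)
  rw [Real.norm_of_nonneg (by positivity), Pi.add_apply]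
  rcases Nat.eq_zero_or_pos (a i) with h0 | h1
  · rw [h0, Nat.cast_zero]
    exact (pow_le_one₀ le_rfl zero_le_one).trans (by simp)
  · have : (a i : ℝ) ^ m ≤ (a i : ℝ) ^ n := pow_le_pow_right₀ (by exact_mod_cast h1) hmn
    linarith

lemma integral_cubic {ι : Type*} [Fintype ι] {p : PMF (ι → ℕ)} {i : ι}
    (h : Integrable (fun a : ι → ℕ => (a i : ℝ) ^ 3) p.toMeasure) (c₀ c₁ c₂ c₃ : ℝ) :
    Integrable (fun a : ι → ℕ => c₀ + c₁ * (a i : ℝ) ^ 1 + c₂ * (a i : ℝ) ^ 2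
      + c₃ * (a i : ℝ) ^ 3) p.toMeasure ∧
    ∫ a, c₀ + c₁ * (a i : ℝ) ^ 1 + c₂ * (a i : ℝ) ^ 2 + c₃ * (a i : ℝ) ^ 3 ∂p.toMeasure
      = c₀ + c₁ * coordMoment p 1 i + c₂ * coordMoment p 2 i + c₃ * coordMoment p 3 i := by
  have h1 := (integrable_pow_of_le (m := 1) (by norm_num) h).const_mul c₁
  have h2 := (integrable_pow_of_le (m := 2) (by norm_num) h).const_mul c₂
  have h3 := h.const_mul c₃
  have h0 : Integrable (fun _ : ι → ℕ => c₀) p.toMeasure := integrable_const c₀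
  have h01 : Integrable (fun a : ι → ℕ => c₀ + c₁ * (a i : ℝ) ^ 1) p.toMeasure := h0.add h1
  have h012 : Integrable (fun a : ι → ℕ => c₀ + c₁ * (a i : ℝ) ^ 1 + c₂ * (a i : ℝ) ^ 2)
      p.toMeasure := h01.add h2
  refine ⟨h012.add h3, ?_⟩
  rw [integral_add h012 h3, integral_add h01 h2, integral_add h0 h1,
    integral_const_mul, integral_const_mul, integral_const_mul]
  simp [coordMoment]

/-! ### One-step moments of the queue lengths -/

namespace UtilityNetwork

open MarkovChain

variable {ι : Type*} [Fintype ι] {g : ℕ → ℝ} {h : ℝ → EReal} (M : UtilityNetwork ι g h)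

/-- The mean service rate `ψᵢ(x)`. -/
noncomputable def serviceRate (x : ι → ℕ) (i : ι) : ℝ := meanService (M.service x) i

lemma serviceRate_nonneg (x : ι → ℕ) (i : ι) : 0 ≤ M.serviceRate x i :=
  integral_nonneg fun _ => by positivity

lemma serviceRate_le_one (x : ι → ℕ) (i : ι) : M.serviceRate x i ≤ 1 := by
  calc M.serviceRate x i ≤ ∫ _, (1 : ℝ) ∂(M.service x).toMeasure :=
        integral_mono Integrable.of_finite Integrable.of_finite fun e => by
          cases e i <;> simp
    _ = 1 := by simp

lemma serviceRate_eq_zero {x : ι → ℕ} {i : ι} (hx : x i = 0) : M.serviceRate x i = 0 :=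
  M.meanService_eq_zero x i hx

/-- Averaging over the service completion of one queue. -/
lemma avg_service (x : ι → ℕ) (i : ι) {f : Bool → ℝ} (hf : ∀ b, 0 ≤ f b) :
    avg (M.service x) (fun e => ENNReal.ofReal (f (e i)))
      = ENNReal.ofReal (M.serviceRate x i * f true + (1 - M.serviceRate x i) * f false) := by
  rw [avg_ofReal (f := fun e : ι → Bool => f (e i)) (fun e => hf (e i)) Integrable.of_finite]
  congr 1
  -- Every function on `Bool` is affine in `toNat`, so the mean of `ηᵢ` determines its law.
  have : ∀ e : ι → Bool, f (e i) = ((e i).toNat : ℝ) * (f true - f false) + f false := fun e => by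
    cases e i <;> simp
  simp only [this]
  rw [integral_add Integrable.of_finite Integrable.of_finite, integral_mul_const, integral_const,
    serviceRate, meanService]
  simp
  ring

lemma avg_step (x : ι → ℕ) (i : ι) {f : ℕ → ℝ} (hf : ∀ n, 0 ≤ f n) :
    avg (M.step x) (fun z => ENNReal.ofReal (f (z i)))
      = avg M.arrival fun a => ENNReal.ofReal (M.serviceRate x i * f (x i - 1 + a i)
          + (1 - M.serviceRate x i) * f (x i + a i)) := by
  rw [step, avg_bind]
  congr 1
  funext a
  rw [avg_map]
  exact M.avg_service x i (f := fun b => f (x i - b.toNat + a i)) fun b => hf _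

/-- The mean of `Xᵢ(k+1)ⁿ`, given `X(k) = x`, when the mean over the service is a cubic polynomial
in the number of arrivals. -/
lemma integral_step {i : ι} (hξ : Integrable (fun a : ι → ℕ => (a i : ℝ) ^ 3) M.arrival.toMeasure)
    (x : ι → ℕ) {n : ℕ} {c₀ c₁ c₂ c₃ : ℝ}
    (hc : ∀ a : ℕ, M.serviceRate x i * ((x i - 1 + a : ℕ) : ℝ) ^ n
      + (1 - M.serviceRate x i) * ((x i + a : ℕ) : ℝ) ^ n
        = c₀ + c₁ * (a : ℝ) ^ 1 + c₂ * (a : ℝ) ^ 2 + c₃ * (a : ℝ) ^ 3) :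
    Integrable (fun z : ι → ℕ => (z i : ℝ) ^ n) (M.step x).toMeasure ∧
    coordMoment (M.step x) n i = c₀ + c₁ * coordMoment M.arrival 1 i
      + c₂ * coordMoment M.arrival 2 i + c₃ * coordMoment M.arrival 3 i := by
  have hp := integral_cubic hξ c₀ c₁ c₂ c₃
  have hnn : ∀ a : ι → ℕ, 0 ≤ c₀ + c₁ * (a i : ℝ) ^ 1 + c₂ * (a i : ℝ) ^ 2
      + c₃ * (a i : ℝ) ^ 3 := fun a => by
    rw [← hc]
    have := M.serviceRate_nonneg x i
    have := sub_nonneg.2 (M.serviceRate_le_one x i)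
    positivity
  have h1 := M.avg_step x i (f := fun m => (m : ℝ) ^ n) fun m => by positivity
  simp only [hc] at h1
  rw [avg_ofReal hnn hp.1] at h1
  have h0 : ∀ z : ι → ℕ, 0 ≤ (z i : ℝ) ^ n := fun z => by positivity
  refine ⟨integrable_of_avg h0 (by rw [h1]; exact ENNReal.ofReal_ne_top), ?_⟩
  rw [coordMoment, integral_eq_toReal_avg h0, h1, ENNReal.toReal_ofReal (integral_nonneg hnn), hp.2]

/-- Truncated subtraction differs from the real one only at an empty queue, where the service rate
is zero. -/
lemma serviceRate_mul_pow (x : ι → ℕ) (i : ι) (a n : ℕ) :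
    M.serviceRate x i * ((x i - 1 + a : ℕ) : ℝ) ^ n
      = M.serviceRate x i * ((x i : ℝ) - 1 + a) ^ n := by
  rcases Nat.eq_zero_or_pos (x i) with h0 | h1
  · simp [M.serviceRate_eq_zero h0]
  · rw [Nat.cast_add, Nat.cast_sub h1, Nat.cast_one]

lemma coordMoment_step_one {i : ι}
    (hξ : Integrable (fun a : ι → ℕ => (a i : ℝ) ^ 3) M.arrival.toMeasure) (x : ι → ℕ) :
    coordMoment (M.step x) 1 i = x i + M.rate i - M.serviceRate x i := by
  rw [(M.integral_step hξ x (n := 1) (c₀ := x i - M.serviceRate x i) (c₁ := 1) (c₂ := 0) (c₃ := 0)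
    fun a => by rw [serviceRate_mul_pow]; push_cast; ring).2, rate]
  ring

lemma coordMoment_step_two {i : ι}
    (hξ : Integrable (fun a : ι → ℕ => (a i : ℝ) ^ 3) M.arrival.toMeasure) (x : ι → ℕ) :
    coordMoment (M.step x) 2 i = (x i : ℝ) ^ 2 + 2 * x i * (M.rate i - M.serviceRate x i)
      + (coordMoment M.arrival 2 i + (1 - 2 * M.rate i) * M.serviceRate x i) := by
  rw [(M.integral_step hξ x (n := 2)
    (c₀ := (x i : ℝ) ^ 2 - 2 * x i * M.serviceRate x i + M.serviceRate x i)
    (c₁ := 2 * x i - 2 * M.serviceRate x i) (c₂ := 1) (c₃ := 0)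
    fun a => by rw [serviceRate_mul_pow]; push_cast; ring).2, rate]
  ring

/-- Since `ηᵢ ∈ {0, 1}`, all its positive powers have mean `ψᵢ`, so the moment is affine in `ψᵢ`.
The terms are grouped by powers of `xᵢ`. -/
lemma integrable_step_cube {i : ι}
    (hξ : Integrable (fun a : ι → ℕ => (a i : ℝ) ^ 3) M.arrival.toMeasure) (x : ι → ℕ) :
    Integrable (fun z : ι → ℕ => (z i : ℝ) ^ 3) (M.step x).toMeasure ∧
    coordMoment (M.step x) 3 i = (x i : ℝ) ^ 3
      + 3 * (x i : ℝ) ^ 2 * (M.rate i - M.serviceRate x i)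
      + 3 * x i * (coordMoment M.arrival 2 i + (1 - 2 * M.rate i) * M.serviceRate x i)
      + (coordMoment M.arrival 3 i
        + (3 * M.rate i - 1 - 3 * coordMoment M.arrival 2 i) * M.serviceRate x i) := by
  have := M.integral_step hξ x (n := 3)
    (c₀ := (x i : ℝ) ^ 3 - 3 * (x i : ℝ) ^ 2 * M.serviceRate x i + 3 * x i * M.serviceRate x i
      - M.serviceRate x i)
    (c₁ := 3 * (x i : ℝ) ^ 2 - 6 * x i * M.serviceRate x i + 3 * M.serviceRate x i)
    (c₂ := 3 * x i - 3 * M.serviceRate x i) (c₃ := 1)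
    fun a => by rw [serviceRate_mul_pow]; push_cast; ring
  refine ⟨this.1, ?_⟩
  rw [this.2, rate]
  ring

end UtilityNetwork

namespace UtilityNetwork

open MarkovChain

variable {ι : Type*} [Fintype ι]

/-! ### Consequences of utility maximisation -/

lemma utility_gSq_hInv {x : ι → ℕ} {μ : ι → ℝ} (hμ : ∀ i, x i ≠ 0 → μ i ≠ 0) :
    utility gSq hInv x μ = ((∑ i, -((x i : ℝ) ^ 2 / μ i) : ℝ) : EReal) := by
  have hcoe := map_sum (⟨⟨Real.toEReal, EReal.coe_zero⟩, EReal.coe_add⟩ : ℝ →+ EReal)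
    (fun i => -((x i : ℝ) ^ 2 / μ i)) Finset.univ
  refine Eq.trans ?_ hcoe.symm
  refine Finset.sum_congr rfl fun i _ => ?_
  by_cases hx : x i = 0
  · simp [gSq, hx]
  · rw [hInv, if_neg (hμ i hx), gSq, ← EReal.coe_mul]
    exact congrArg Real.toEReal (by ring)

lemma utility_gSq_hInv_eq_bot {x : ι → ℕ} {μ : ι → ℝ} {i : ι} (hx : x i ≠ 0) (hμ : μ i = 0) :
    utility gSq hInv x μ = ⊥ := by
  classical
  rw [utility, ← Finset.add_sum_erase _ _ (Finset.mem_univ i), hInv, if_pos hμ,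
    EReal.coe_mul_bot_of_pos (by rw [gSq]; positivity), EReal.bot_add]

variable (M : UtilityNetwork ι gSq hInv) {ν : ι → ℝ}

/-- The first-order condition for the maximiser, in terms of an arbitrary competitor. -/
lemma sum_sq_mul_sub_serviceRate_le (hν : ν ∈ M.C) (hpos : ∀ i, 0 < ν i) (x : ι → ℕ) :
    ∑ i, (x i : ℝ) ^ 2 * (ν i - M.serviceRate x i) / ν i ^ 2 ≤ 0 := by
  have hmax : utility gSq hInv x ν ≤ utility gSq hInv x (M.serviceRate x) := M.utility_le x ν hν
  rw [utility_gSq_hInv fun i _ => (hpos i).ne'] at hmax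
  -- The competitor `ν` has finite utility, whereas a zero rate at a nonempty queue would give `-∞`.
  have hψ : ∀ i, x i ≠ 0 → M.serviceRate x i ≠ 0 := fun i hx h0 => by
    rw [utility_gSq_hInv_eq_bot hx h0, le_bot_iff] at hmax
    exact EReal.coe_ne_bot _ hmax
  rw [utility_gSq_hInv hψ, EReal.coe_le_coe_iff, Finset.sum_neg_distrib, Finset.sum_neg_distrib,
    neg_le_neg_iff, ← sub_nonpos, ← Finset.sum_sub_distrib] at hmax
  refine le_trans (Finset.sum_le_sum fun i _ => ?_) hmax
  by_cases hx : x i = 0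
  · simp [hx]
  have hψi : 0 < M.serviceRate x i := (M.serviceRate_nonneg x i).lt_of_ne' (hψ i hx)
  have hνi := hpos i
  -- Tangent of the convex function `1/μ` at `νᵢ`; the gap is `(νᵢ - ψᵢ)²/(ψᵢ νᵢ²)`.
  have htangent : (ν i - M.serviceRate x i) / ν i ^ 2 ≤ 1 / M.serviceRate x i - 1 / ν i := by
    rw [div_sub_div _ _ hψi.ne' hνi.ne', div_le_div_iff₀ (by positivity) (by positivity)]
    nlinarith [mul_nonneg hνi.le (sq_nonneg (ν i - M.serviceRate x i))]
  calc _ = (x i : ℝ) ^ 2 * ((ν i - M.serviceRate x i) / ν i ^ 2) := by ring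
    _ ≤ (x i : ℝ) ^ 2 * (1 / M.serviceRate x i - 1 / ν i) := by gcongr
    _ = (x i : ℝ) ^ 2 / M.serviceRate x i - (x i : ℝ) ^ 2 / ν i := by ring

/-- With a single customer, in queue `i`, the first-order condition reads `νᵢ ≤ ψᵢ`, and `ψᵢ` is a
probability. -/
lemma le_one_of_mem (hν : ν ∈ M.C) (hpos : ∀ i, 0 < ν i) (i : ι) : ν i ≤ 1 := by
  classical
  have h := M.sum_sq_mul_sub_serviceRate_le hν hpos (Pi.single i 1)
  rw [Finset.sum_eq_single i (fun j _ hj => by simp [Pi.single_eq_of_ne hj])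
    (fun hi => (hi (Finset.mem_univ i)).elim)] at h
  have hνi := hpos i
  rw [div_le_iff₀ (by positivity)] at h
  simp only [Pi.single_eq_same, Nat.cast_one] at h
  linarith [M.serviceRate_le_one (Pi.single i 1) i]

/-! ### The drift of the weighted sum of cubes -/

lemma rate_nonneg (i : ι) : 0 ≤ M.rate i := coordMoment_nonneg _ _ _

/-- The Lyapunov function `∑ᵢ xᵢ³ / νᵢ²`. -/
noncomputable def lyapunov (ν : ι → ℝ) (x : ι → ℕ) : ℝ := ∑ i, (x i : ℝ) ^ 3 / ν i ^ 2

lemma lyapunov_nonneg (ν : ι → ℝ) (x : ι → ℕ) : 0 ≤ lyapunov ν x :=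
  Finset.sum_nonneg fun _ _ => by positivity

/-- The part of the drift of the `i`-th cube that grows at most linearly. -/
noncomputable def lowerDrift (x : ι → ℕ) (i : ι) : ℝ :=
  3 * x i * (coordMoment M.arrival 2 i + (1 - 2 * M.rate i) * M.serviceRate x i)
    + (coordMoment M.arrival 3 i
      + (3 * M.rate i - 1 - 3 * coordMoment M.arrival 2 i) * M.serviceRate x i)

variable {M}

lemma integrable_lyapunov
    (hξ : ∀ i, Integrable (fun a : ι → ℕ => (a i : ℝ) ^ 3) M.arrival.toMeasure) (x : ι → ℕ) :
    Integrable (lyapunov ν) (M.step x).toMeasure :=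
  integrable_finsetSum _ fun i _ => (M.integrable_step_cube (hξ i) x).1.div_const _

/-- Write `λᵢ - ψᵢ = (λᵢ - νᵢ) + (νᵢ - ψᵢ)` in the quadratic part: the first bracket is below `-ε`,
and the second contributes a nonpositive sum by the first-order condition. -/
lemma integral_lyapunov_le (hν : ν ∈ M.C) (hpos : ∀ i, 0 < ν i)
    (hξ : ∀ i, Integrable (fun a : ι → ℕ => (a i : ℝ) ^ 3) M.arrival.toMeasure) {ε : ℝ}
    (hε : ∀ i, M.rate i < ν i - ε) (x : ι → ℕ) :
    ∫ z, lyapunov ν z ∂(M.step x).toMeasure + 3 * ε * ∑ i, (x i : ℝ) ^ 2 / ν i ^ 2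
      ≤ lyapunov ν x + ∑ i, M.lowerDrift x i / ν i ^ 2 := by
  have h0 := M.sum_sq_mul_sub_serviceRate_le hν hpos x
  have h1 : ∫ z, lyapunov ν z ∂(M.step x).toMeasure
      = ∑ i, coordMoment (M.step x) 3 i / ν i ^ 2 := by
    simp only [lyapunov]
    rw [integral_finsetSum _ fun i _ => (M.integrable_step_cube (hξ i) x).1.div_const _]
    exact Finset.sum_congr rfl fun i _ => integral_div _ _
  rw [h1, lyapunov, Finset.mul_sum, ← Finset.sum_add_distrib, ← Finset.sum_add_distrib]
  refine le_trans (b := ∑ i, ((x i : ℝ) ^ 3 / ν i ^ 2 + M.lowerDrift x i / ν i ^ 2)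
    + 3 * ∑ i, (x i : ℝ) ^ 2 * (ν i - M.serviceRate x i) / ν i ^ 2) ?_ (by linarith)
  rw [Finset.mul_sum, ← Finset.sum_add_distrib]
  refine Finset.sum_le_sum fun i _ => ?_
  rw [(M.integrable_step_cube (hξ i) x).2, lowerDrift]
  have h2 : 0 ≤ (x i : ℝ) ^ 2 / ν i ^ 2 * (ν i - ε - M.rate i) :=
    mul_nonneg (by positivity) (sub_nonneg.2 (hε i).le)
  calc _ ≤ _ + 3 * ((x i : ℝ) ^ 2 / ν i ^ 2 * (ν i - ε - M.rate i)) :=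
        le_add_of_nonneg_right (by positivity)
    _ = _ := by ring

lemma exists_lowerDrift_le (hν : ν ∈ M.C) (hpos : ∀ i, 0 < ν i) (hlt : ∀ i, M.rate i < ν i)
    {ε : ℝ} (hε : 0 < ε) :
    ∃ b, 0 ≤ b ∧ ∀ x, ∑ i, M.lowerDrift x i / ν i ^ 2
      ≤ 2 * ε * ∑ i, (x i : ℝ) ^ 2 / ν i ^ 2 + b := by
  -- Here `3 c i` bounds the coefficient of `xᵢ`. The term `9c²/(8ε)` completes the square against
  -- `2εx²`, and `2` bounds the part of the constant term that carries `ψᵢ`.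
  set c : ι → ℝ := fun i => coordMoment M.arrival 2 i + 1
  set d : ι → ℝ := fun i => 9 * c i ^ 2 / (8 * ε) + coordMoment M.arrival 3 i + 2
  have hd : ∀ i, 0 ≤ d i := fun i => by
    have := coordMoment_nonneg M.arrival 3 i
    positivity
  refine ⟨∑ i, d i / ν i ^ 2, Finset.sum_nonneg fun i _ => div_nonneg (hd i) (by positivity),
    fun x => ?_⟩
  rw [Finset.mul_sum, ← Finset.sum_add_distrib]
  refine Finset.sum_le_sum fun i _ => ?_
  rw [← mul_div_assoc, ← add_div]
  refine div_le_div_of_nonneg_right ?_ (by positivity)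
  have hψ0 := M.serviceRate_nonneg x i
  have hψ1 := M.serviceRate_le_one x i
  have hm2 := coordMoment_nonneg M.arrival 2 i
  have hr0 := M.rate_nonneg i
  have hr1 : M.rate i ≤ 1 := (hlt i).le.trans (M.le_one_of_mem hν hpos i)
  have h1 : (1 - 2 * M.rate i) * M.serviceRate x i ≤ 1 := by nlinarith
  have h2 : (3 * M.rate i - 1 - 3 * coordMoment M.arrival 2 i) * M.serviceRate x i ≤ 2 := by
    nlinarith [mul_nonneg hm2 hψ0, mul_le_mul hr1 hψ1 hψ0 zero_le_one]
  have h3 : 3 * (x i : ℝ) * c i ≤ 2 * ε * (x i : ℝ) ^ 2 + 9 * c i ^ 2 / (8 * ε) := by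
    have h4 : 2 * ε * (x i : ℝ) ^ 2 + 9 * c i ^ 2 / (8 * ε) - 3 * (x i : ℝ) * c i
        = (4 * ε * x i - 3 * c i) ^ 2 / (8 * ε) := by
      field_simp
      ring
    have : 0 ≤ (4 * ε * x i - 3 * c i) ^ 2 / (8 * ε) := by positivity
    linarith
  have h5 : 3 * (x i : ℝ) * (coordMoment M.arrival 2 i
      + (1 - 2 * M.rate i) * M.serviceRate x i) ≤ 3 * x i * c i := by
    gcongr
    simp only [c]
    linarith
  simp only [lowerDrift, d]
  linarith

/-- Of the decrease `3ε ∑ xᵢ²/νᵢ²`, the share `2ε` absorbs the lower-order terms and `ε` remains. -/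
lemma integral_lyapunov_add_le (hν : ν ∈ M.C) (hpos : ∀ i, 0 < ν i)
    (hξ : ∀ i, Integrable (fun a : ι → ℕ => (a i : ℝ) ^ 3) M.arrival.toMeasure)
    (hlt : ∀ i, M.rate i < ν i) :
    ∃ ε > 0, ∃ b, 0 ≤ b ∧ ∀ x, ∫ z, lyapunov ν z ∂(M.step x).toMeasure
      + ε * ∑ i, (x i : ℝ) ^ 2 / ν i ^ 2 ≤ lyapunov ν x + b := by
  obtain ⟨ε, hε, hε0⟩ : ∃ ε : ℝ, (∀ i, M.rate i < ν i - ε) ∧ 0 < ε := by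
    have h1 : ∀ᶠ ε in nhdsWithin (0 : ℝ) (Set.Ioi 0), ∀ i, M.rate i < ν i - ε :=
      Filter.eventually_all.2 fun i => by
        filter_upwards [Ioo_mem_nhdsGT (sub_pos.2 (hlt i))] with ε hε
        linarith [hε.2]
    exact (h1.and self_mem_nhdsWithin).exists
  obtain ⟨b, hb, hle⟩ := exists_lowerDrift_le hν hpos hlt hε0
  exact ⟨ε, hε0, b, hb, fun x => by linarith [hle x, integral_lyapunov_le hν hpos hξ hε x]⟩

lemma finite_setOf_sum_lt (hpos : ∀ i, 0 < ν i) {ε : ℝ} (hε : 0 < ε) (b : ℝ) :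
    {x : ι → ℕ | ε * ∑ i, (x i : ℝ) ^ 2 / ν i ^ 2 < b}.Finite := by
  classical
  refine (Set.finite_Iic fun i => ⌈b / ε * ν i ^ 2⌉₊).subset fun x hx i => ?_
  have hνi := hpos i
  have h1 : (x i : ℝ) ^ 2 / ν i ^ 2 ≤ ∑ i, (x i : ℝ) ^ 2 / ν i ^ 2 :=
    Finset.single_le_sum (f := fun i => (x i : ℝ) ^ 2 / ν i ^ 2) (fun _ _ => by positivity)
      (Finset.mem_univ i)
  have h2 : (x i : ℝ) ^ 2 / ν i ^ 2 ≤ b / ε := by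
    rw [le_div_iff₀ hε, mul_comm]
    exact (mul_le_mul_of_nonneg_left h1 hε.le).trans (le_of_lt hx)
  rw [div_le_iff₀ (by positivity)] at h2
  have h3 : (x i : ℝ) ≤ (x i : ℝ) ^ 2 := by exact_mod_cast Nat.le_self_pow two_ne_zero (x i)
  exact_mod_cast (h3.trans h2).trans (Nat.le_ceil _)

lemma isPositiveRecurrentOn_step (hν : ν ∈ M.C) (hpos : ∀ i, 0 < ν i)
    (hξ : ∀ i, Integrable (fun a : ι → ℕ => (a i : ℝ) ^ 3) M.arrival.toMeasure)
    (hlt : ∀ i, M.rate i < ν i) {S : Set (ι → ℕ)} (hS : IsClosedSet M.step S) :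
    IsPositiveRecurrentOn M.step S := by
  obtain ⟨ε, hε, b, hb, h⟩ := integral_lyapunov_add_le hν hpos hξ hlt
  exact isPositiveRecurrentOn_of_integral_drift hS (lyapunov_nonneg ν) (fun x => by positivity)
    (integrable_lyapunov hξ) hb (finite_setOf_sum_lt hpos hε _) h

/-! ### Stationary moments -/

lemma integrable_sq (hν : ν ∈ M.C) (hpos : ∀ i, 0 < ν i)
    (hξ : ∀ i, Integrable (fun a : ι → ℕ => (a i : ℝ) ^ 3) M.arrival.toMeasure)
    (hlt : ∀ i, M.rate i < ν i) {S : Set (ι → ℕ)} {π : PMF (ι → ℕ)}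
    (hπ : IsStationaryOn M.step S π) (i : ι) :
    Integrable (fun x : ι → ℕ => (x i : ℝ) ^ 2) π.toMeasure := by
  obtain ⟨ε, hε, b, hb, h⟩ := integral_lyapunov_add_le hν hpos hξ hlt
  have h1 := (hπ.integral_le_integral (lyapunov_nonneg ν) (fun x => by positivity) (fun _ => hb)
    (integrable_lyapunov hξ) h (integrable_const b)).1
  have hνi := hpos i
  refine (h1.const_mul (ν i ^ 2 / ε)).mono' (measurable_of_countable _).aestronglyMeasurable
    (Filter.Eventually.of_forall fun x => ?_)
  rw [Real.norm_of_nonneg (by positivity)]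
  calc (x i : ℝ) ^ 2 = ν i ^ 2 / ε * (ε * ((x i : ℝ) ^ 2 / ν i ^ 2)) := by field_simp
    _ ≤ _ := by
      gcongr
      exact Finset.single_le_sum (f := fun i => (x i : ℝ) ^ 2 / ν i ^ 2)
        (fun _ _ => by positivity) (Finset.mem_univ i)

section balance

variable {S : Set (ι → ℕ)} {π : PMF (ι → ℕ)} {i : ι}

lemma integrable_serviceRate : Integrable (fun x => M.serviceRate x i) π.toMeasure :=
  (integrable_const (1 : ℝ)).mono' (measurable_of_countable _).aestronglyMeasurable
    (Filter.Eventually.of_forall fun x => by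
      rw [Real.norm_of_nonneg (M.serviceRate_nonneg x i)]
      exact M.serviceRate_le_one x i)

lemma integrable_mul_serviceRate (h1 : Integrable (fun x : ι → ℕ => (x i : ℝ)) π.toMeasure) :
    Integrable (fun x => (x i : ℝ) * M.serviceRate x i) π.toMeasure :=
  h1.mono' (measurable_of_countable _).aestronglyMeasurable
    (Filter.Eventually.of_forall fun x => by
      rw [Real.norm_of_nonneg (mul_nonneg (Nat.cast_nonneg _) (M.serviceRate_nonneg x i))]
      exact mul_le_of_le_one_right (Nat.cast_nonneg _) (M.serviceRate_le_one x i))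

/-- In the stationary regime the mean service rate is the arrival rate. -/
lemma integral_serviceRate (hξ : Integrable (fun a : ι → ℕ => (a i : ℝ) ^ 3) M.arrival.toMeasure)
    (hπ : IsStationaryOn M.step S π)
    (h1 : Integrable (fun x : ι → ℕ => (x i : ℝ)) π.toMeasure) :
    ∫ x, M.serviceRate x i ∂π.toMeasure = M.rate i := by
  have h := hπ.integral_integral (V := fun z : ι → ℕ => (z i : ℝ) ^ 1) (fun z => by positivity)
    fun x => integrable_pow_of_le (by norm_num) (M.integrable_step_cube hξ x).1
  change ∫ x, coordMoment (M.step x) 1 i ∂π.toMeasure = coordMoment π 1 i at h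
  simp only [M.coordMoment_step_one hξ] at h
  have hx : Integrable (fun x : ι → ℕ => (x i : ℝ) + M.rate i) π.toMeasure :=
    h1.add (integrable_const _)
  rw [integral_sub hx integrable_serviceRate, integral_add h1 (integrable_const _),
    coordMoment_one] at h
  simp only [integral_const, probReal_univ, one_smul] at h
  linarith

lemma integral_affine (hξ : Integrable (fun a : ι → ℕ => (a i : ℝ) ^ 3) M.arrival.toMeasure)
    (hπ : IsStationaryOn M.step S π)
    (h1 : Integrable (fun x : ι → ℕ => (x i : ℝ)) π.toMeasure) (c₀ c₁ c₂ c₃ : ℝ) :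
    Integrable (fun x => c₀ + c₁ * x i + c₂ * M.serviceRate x i
      + c₃ * ((x i : ℝ) * M.serviceRate x i)) π.toMeasure ∧
    ∫ x, c₀ + c₁ * x i + c₂ * M.serviceRate x i + c₃ * ((x i : ℝ) * M.serviceRate x i) ∂π.toMeasure
      = c₀ + c₁ * coordMoment π 1 i + c₂ * M.rate i
        + c₃ * ∫ x, (x i : ℝ) * M.serviceRate x i ∂π.toMeasure := by
  have hc : Integrable (fun _ : ι → ℕ => c₀) π.toMeasure := integrable_const _
  have hx := h1.const_mul c₁
  have hψ := (integrable_serviceRate (M := M) (π := π) (i := i)).const_mul c₂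
  have hxψ := (integrable_mul_serviceRate (M := M) h1).const_mul c₃
  have hcx : Integrable (fun x : ι → ℕ => c₀ + c₁ * x i) π.toMeasure := hc.add hx
  have hcxψ : Integrable (fun x => c₀ + c₁ * x i + c₂ * M.serviceRate x i) π.toMeasure :=
    hcx.add hψ
  refine ⟨hcxψ.add hxψ, ?_⟩
  rw [integral_add hcxψ hxψ, integral_add hcx hψ, integral_add hc hx, integral_const_mul,
    integral_const_mul, integral_const_mul, integral_serviceRate hξ hπ h1, integral_const,
    ← coordMoment_one, probReal_univ, one_smul]

/-- Stationarity of the second moment: its two occurrences cancel, being finite, and a linear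
equation for the mean of `xᵢψᵢ` is left. -/
lemma integral_mul_serviceRate
    (hξ : Integrable (fun a : ι → ℕ => (a i : ℝ) ^ 3) M.arrival.toMeasure)
    (hπ : IsStationaryOn M.step S π)
    (h2 : Integrable (fun x : ι → ℕ => (x i : ℝ) ^ 2) π.toMeasure) :
    ∫ x, (x i : ℝ) * M.serviceRate x i ∂π.toMeasure
      = M.rate i * coordMoment π 1 i
        + (coordMoment M.arrival 2 i + (1 - 2 * M.rate i) * M.rate i) / 2 := by
  have h1 : Integrable (fun x : ι → ℕ => (x i : ℝ)) π.toMeasure := by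
    simpa using integrable_pow_of_le (m := 1) (by norm_num) h2
  have h := hπ.integral_integral (V := fun z : ι → ℕ => (z i : ℝ) ^ 2) (fun z => by positivity)
    fun x => integrable_pow_of_le (by norm_num) (M.integrable_step_cube hξ x).1
  change ∫ x, coordMoment (M.step x) 2 i ∂π.toMeasure = coordMoment π 2 i at h
  have hexp : ∀ x : ι → ℕ, coordMoment (M.step x) 2 i
      = (x i : ℝ) ^ 2 + (coordMoment M.arrival 2 i + 2 * M.rate i * x i
        + (1 - 2 * M.rate i) * M.serviceRate x i + -2 * ((x i : ℝ) * M.serviceRate x i)) :=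
    fun x => by rw [M.coordMoment_step_two hξ]; ring
  have haff := integral_affine hξ hπ h1 (coordMoment M.arrival 2 i) (2 * M.rate i)
    (1 - 2 * M.rate i) (-2)
  simp only [hexp] at h
  rw [integral_add h2 haff.1, haff.2, ← coordMoment] at h
  linarith

/-- The lower drift is affine in `xᵢ`, `ψᵢ` and `xᵢψᵢ`, and the two balance equations eliminate
`ψᵢ`. This is the origin of the summands of `A` and `B`. -/
lemma integral_lowerDrift
    (hξ : Integrable (fun a : ι → ℕ => (a i : ℝ) ^ 3) M.arrival.toMeasure)
    (hπ : IsStationaryOn M.step S π)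
    (h2 : Integrable (fun x : ι → ℕ => (x i : ℝ) ^ 2) π.toMeasure) :
    Integrable (fun x => M.lowerDrift x i) π.toMeasure ∧
    ∫ x, M.lowerDrift x i ∂π.toMeasure
      = 3 * (coordMoment M.arrival 2 i + M.rate i * (1 - 2 * M.rate i)) * coordMoment π 1 i
        + (coordMoment M.arrival 3 i - M.rate i + 3 * M.rate i ^ 2
          - 3 * M.rate i * coordMoment M.arrival 2 i
          - 3 * (1 - 2 * M.rate i) *
            (M.rate i ^ 2 - M.rate i / 2 - coordMoment M.arrival 2 i / 2)) := by
  have h1 : Integrable (fun x : ι → ℕ => (x i : ℝ)) π.toMeasure := by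
    simpa using integrable_pow_of_le (m := 1) (by norm_num) h2
  have hexp : ∀ x : ι → ℕ, M.lowerDrift x i = coordMoment M.arrival 3 i
      + 3 * coordMoment M.arrival 2 i * x i
      + (3 * M.rate i - 1 - 3 * coordMoment M.arrival 2 i) * M.serviceRate x i
      + 3 * (1 - 2 * M.rate i) * ((x i : ℝ) * M.serviceRate x i) := fun x => by
    rw [lowerDrift]; ring
  have haff := integral_affine hξ hπ h1 (coordMoment M.arrival 3 i) (3 * coordMoment M.arrival 2 i)
    (3 * M.rate i - 1 - 3 * coordMoment M.arrival 2 i) (3 * (1 - 2 * M.rate i))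
  simp only [hexp]
  refine ⟨haff.1, ?_⟩
  rw [haff.2, integral_mul_serviceRate hξ hπ h2]
  ring

end balance

/-! ### The stationary bound -/

lemma rate_le_coordMoment_two {i : ι}
    (hξ : Integrable (fun a : ι → ℕ => (a i : ℝ) ^ 3) M.arrival.toMeasure) :
    M.rate i ≤ coordMoment M.arrival 2 i :=
  integral_mono (integrable_pow_of_le (by norm_num) hξ) (integrable_pow_of_le (by norm_num) hξ)
    fun a => by
      simp only [pow_one]
      exact_mod_cast Nat.le_self_pow two_ne_zero (a i)

/-- The comparison theorem needs nonnegative functions, so the lower drift has to be bounded below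
and shifted. -/
lemma neg_le_lowerDrift {i : ι}
    (hξ : Integrable (fun a : ι → ℕ => (a i : ℝ) ^ 3) M.arrival.toMeasure)
    (h1 : M.rate i ≤ 1) (x : ι → ℕ) :
    -(1 + 3 * coordMoment M.arrival 2 i) ≤ M.lowerDrift x i := by
  have hψ0 := M.serviceRate_nonneg x i
  have hψ1 := M.serviceRate_le_one x i
  have hm2 := coordMoment_nonneg M.arrival 2 i
  have hm3 := coordMoment_nonneg M.arrival 3 i
  have hr0 := M.rate_nonneg i
  have hr2 := rate_le_coordMoment_two hξ
  -- As `𝔼 ξᵢ² ≥ λᵢ`, this is at least `λᵢ(1 - ψᵢ) + ψᵢ(1 - λᵢ)`.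
  have h2 : 0 ≤ coordMoment M.arrival 2 i + (1 - 2 * M.rate i) * M.serviceRate x i := by
    nlinarith [mul_nonneg hr0 (sub_nonneg.2 hψ1), mul_nonneg hψ0 (sub_nonneg.2 h1)]
  have h3 : 0 ≤ 3 * (x i : ℝ) * (coordMoment M.arrival 2 i
      + (1 - 2 * M.rate i) * M.serviceRate x i) := by positivity
  have h4 : -(1 + 3 * coordMoment M.arrival 2 i)
      ≤ (3 * M.rate i - 1 - 3 * coordMoment M.arrival 2 i) * M.serviceRate x i := by
    nlinarith [mul_nonneg hm2 (sub_nonneg.2 hψ1), mul_nonneg hr0 hψ0]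
  rw [lowerDrift]
  linarith

lemma three_mul_sum_coordMoment_le (hν : ν ∈ M.C) (hpos : ∀ i, 0 < ν i)
    (hξ : ∀ i, Integrable (fun a : ι → ℕ => (a i : ℝ) ^ 3) M.arrival.toMeasure)
    {S : Set (ι → ℕ)} {π : PMF (ι → ℕ)} (hπ : IsStationaryOn M.step S π)
    (h2 : ∀ i, Integrable (fun x : ι → ℕ => (x i : ℝ) ^ 2) π.toMeasure) {ε : ℝ} (hε0 : 0 < ε)
    (hε : ∀ i, M.rate i < ν i - ε) :
    3 * ε * ∑ i, coordMoment π 2 i / ν i ^ 2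
      ≤ ∑ i, 3 * (coordMoment M.arrival 2 i + M.rate i * (1 - 2 * M.rate i))
          * coordMoment π 1 i / ν i ^ 2 + M.constB ν := by
  -- The shift that makes the right side of the drift inequality nonnegative; it is added to both
  -- sides and cancels after integration.
  set K : ℝ := ∑ i, (1 + 3 * coordMoment M.arrival 2 i) / ν i ^ 2
  have hK : 0 ≤ K := Finset.sum_nonneg fun i _ => by
    have := coordMoment_nonneg M.arrival 2 i
    positivity
  have hlow : ∀ x, 0 ≤ ∑ i, M.lowerDrift x i / ν i ^ 2 + K := fun x => by
    rw [← Finset.sum_add_distrib]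
    refine Finset.sum_nonneg fun i _ => ?_
    rw [← add_div]
    have hr1 : M.rate i ≤ 1 := by linarith [hε i, M.le_one_of_mem hν hpos i]
    have := neg_le_lowerDrift (hξ i) hr1 x
    exact div_nonneg (by linarith) (by positivity)
  have hl := fun i => integral_lowerDrift (hξ i) hπ (h2 i)
  have hli : ∀ i ∈ Finset.univ, Integrable (fun x => M.lowerDrift x i / ν i ^ 2) π.toMeasure :=
    fun i _ => (hl i).1.div_const _
  have hsi : ∀ i ∈ Finset.univ, Integrable (fun x : ι → ℕ => (x i : ℝ) ^ 2 / ν i ^ 2)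
      π.toMeasure := fun i _ => (h2 i).div_const _
  have key := (hπ.integral_le_integral (lyapunov_nonneg ν)
    (f := fun x => 3 * ε * ∑ i, (x i : ℝ) ^ 2 / ν i ^ 2 + K) (fun x => by positivity) hlow
    (integrable_lyapunov hξ) (fun x => by linarith [integral_lyapunov_le hν hpos hξ hε x])
    ((integrable_finsetSum _ hli).add (integrable_const K))).2
  rw [integral_add ((integrable_finsetSum _ hsi).const_mul _) (integrable_const K),
    integral_add (integrable_finsetSum _ hli) (integrable_const K), add_le_add_iff_right,
    integral_const_mul, integral_finsetSum _ hsi, integral_finsetSum _ hli] at key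
  simp only [integral_div, fun i => (hl i).2, add_div, Finset.sum_add_distrib] at key
  exact key

/-- Each coefficient is nonnegative, being at least `2λᵢ(1 - λᵢ)`. Since `νᵢ ≤ 1`, dividing it by
`νᵢ²` only enlarges it, and the sum in `A` dominates each of its terms. -/
lemma constA_mul_ge (hν : ν ∈ M.C) (hpos : ∀ i, 0 < ν i)
    (hξ : ∀ i, Integrable (fun a : ι → ℕ => (a i : ℝ) ^ 3) M.arrival.toMeasure)
    (hlt : ∀ i, M.rate i < ν i) {y : ι → ℝ} (hy : ∀ i, 0 ≤ y i) :
    ∑ i, 3 * (coordMoment M.arrival 2 i + M.rate i * (1 - 2 * M.rate i)) * y i / ν i ^ 2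
      ≤ M.constA ν * ∑ i, y i / ν i ^ 2 := by
  have ha : ∀ i, 0 ≤ coordMoment M.arrival 2 i + M.rate i * (1 - 2 * M.rate i) := fun i => by
    have hr1 : M.rate i ≤ 1 := (hlt i).le.trans (M.le_one_of_mem hν hpos i)
    nlinarith [rate_le_coordMoment_two (hξ i), mul_nonneg (M.rate_nonneg i) (sub_nonneg.2 hr1)]
  rw [Finset.mul_sum]
  refine Finset.sum_le_sum fun i _ => ?_
  rw [mul_div_assoc]
  refine mul_le_mul_of_nonneg_right ?_ (div_nonneg (hy i) (by positivity))
  rw [constA]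
  gcongr
  have hνi := hpos i
  calc _ ≤ (coordMoment M.arrival 2 i + M.rate i * (1 - 2 * M.rate i)) / ν i ^ 2 :=
        le_div_self (ha i) (by positivity) (pow_le_one₀ hνi.le (M.le_one_of_mem hν hpos i))
    _ ≤ _ := Finset.single_le_sum
        (f := fun i => (coordMoment M.arrival 2 i + M.rate i * (1 - 2 * M.rate i)) / ν i ^ 2)
        (fun i _ => div_nonneg (ha i) (by positivity)) (Finset.mem_univ i)

end UtilityNetwork

theorem theorem3 {ι : Type*} [Fintype ι] (M : UtilityNetwork ι gSq hInv)
    (hξ : ∀ i, Integrable (fun a : ι → ℕ => (a i : ℝ) ^ 3) M.arrival.toMeasure)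
    (ν : ι → ℝ) (hν : ν ∈ M.C) (hlt : ∀ i, M.rate i < ν i)
    (S : Set (ι → ℕ)) (hS : MarkovChain.IsIrreducibleOn M.step S) :
    MarkovChain.IsPositiveRecurrentOn M.step S ∧
    (∃! π : PMF (ι → ℕ), MarkovChain.IsStationaryOn M.step S π) ∧
    ∀ π : PMF (ι → ℕ), MarkovChain.IsStationaryOn M.step S π →
      (∀ i, Integrable (fun x : ι → ℕ => (x i : ℝ) ^ 2) π.toMeasure) ∧
      ∀ ε : ℝ, 0 < ε → (∀ i, M.rate i < ν i - ε) →
        ε * ∑ i, coordMoment π 2 i / ν i ^ 2 ≤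
          M.constA ν * (∑ i, coordMoment π 1 i / ν i ^ 2) + M.constB ν := by
  have hpos : ∀ i, 0 < ν i := fun i => (M.rate_nonneg i).trans_lt (hlt i)
  have hrec := UtilityNetwork.isPositiveRecurrentOn_step hν hpos hξ hlt hS.1
  refine ⟨hrec, hrec.existsUnique hS, fun π hπ => ?_⟩
  have h2 := UtilityNetwork.integrable_sq hν hpos hξ hlt hπ
  refine ⟨h2, fun ε hε0 hε => ?_⟩
  have h3 := UtilityNetwork.three_mul_sum_coordMoment_le hν hpos hξ hπ h2 hε0 hε
  have hA := UtilityNetwork.constA_mul_ge hν hpos hξ hlt fun i => coordMoment_nonneg π 1 i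
  -- Nonnegativity weakens the bound from `3ε` to `ε`.
  have h0 : 0 ≤ ε * ∑ i, coordMoment π 2 i / ν i ^ 2 :=
    mul_nonneg hε0.le (Finset.sum_nonneg fun i _ =>
      div_nonneg (coordMoment_nonneg π 2 i) (by positivity))
  linarith
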